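/- **Setting.** Fix a set $\mathcal N$ of names. Visible actions are the inputs $a$ and the outputs $\bar a$ ($a\in\mathcal N$), with $\overline{\bar a}=a$; $\mathit{Act}$ is the set of visible actions, and $\tau$ is the invisible action. An LTS has a set of states and a transition relation labelled by $\mathit{Act}\cup\{\tau\}$. An LTS is in $\mathsf{Fdb}$ (output-buffered agents with feedback) if it comes with an equivalence $\simeq$ on states (for instance equality) such that $p\simeq q\xrightarrow{\alpha}q'$ implies $p\xrightarrow{\alpha}p'\simeq q'$ for some $p'$, and if the following axioms hold up to $\simeq$: - (Output-commutativity) if $p\xrightarrow{\bar a}p'\xrightarrow{\alpha}q$ then $p\xrightarrow{\alpha}p''\xrightarrow{\bar a}q$ for some $p''$; - (Feedback) if $p\xrightarrow{\bar a}p'\xrightarrow{a}q$ then $p\xrightarrow{\tau}q$; - (Output-confluence) if $p\xrightarrow{\bar a}p'$ and $p\xrightarrow{\alpha}p''$ with $\alpha\notin\{\bar a,\tau\}$, then $p'\xrightarrow{\alpha}q$ and $p''\xrightarrow{\bar a}q$ for some $q$; - (Output-determinacy) if $p\xrightarrow{\bar a}p'$ and $p\xrightarrow{\bar a}p''$ then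 $p'=p''$; - (Output-tau) if $p\xrightarrow{\bar a}p'$ and $p\xrightarrow{\tau}p''$, then either $p'\xrightarrow{\tau}q$ and $p''\xrightarrow{\bar a}q$ for some $q$, or $p'\xrightarrow{a}p''$; - (Backward-output-determinacy) if $p'\xrightarrow{\bar a}p$ and $p''\xrightarrow{\bar a}p$ then $p'=p''$; - each state $p$ has a finite multiset $\mathsf{mbox}(p)$ of outputs such that $\bar a\in\mathsf{mbox}(p)$ iff $p\xrightarrow{\bar a}$, and $p\xrightarrow{\bar a}p'$ implies $\mathsf{mbox}(p)=\{\!|\bar a|\!\}\uplus\mathsf{mbox}(p')$. A *client LTS* is an LTS in $\mathsf{Fdb}$ with a predicate $\mathrm{good}$ on its states that is preserved by $\simeq$ and satisfies $\mathrm{good}(r)\Leftrightarrow\mathrm{good}(r')$ whenever $r\xrightarrow{\bar a}r'$. A system $p\,[\!]\,r$ of a server $p$ and a client $r$ reduces by a $\tau$-transition of $p$, by a $\tau$-transition of $r$, or by transitions $p\xrightarrow{\mu}p'$ and $r\xrightarrow{\bar\mu}r'$ performed together. Write $p\ \mathrm{must}\ r$ if every maximal (infinite or non-extendable) computation of $p\,[\!]\,r$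 visits a system $p_i\,[\!]\,r_i$ with $\mathrm{good}(r_i)$. Write $p\sqsubseteq_{\mathrm{must}}q$ if $p\ \mathrm{must}\ r$ implies $q\ \mathrm{must}\ r$ for every client $r$. Let $p\stackrel{s}{\Rightarrow}p'$ be the weak transitions along a trace $s\in\mathit{Act}^\star$, and let $p{\downarrow}$ mean that $p$ has no infinite sequence of $\tau$-transitions. Let $p\Downarrow s$ be the least relation such that $p\Downarrow\varepsilon$ if $p{\downarrow}$, and $p\Downarrow\mu.s$ if $p{\downarrow}$ and $p'\Downarrow s$ for every $p'$ with $p\stackrel{\mu}{\Rightarrow}p'$. A finite set $X$ of visible actions is a must-set of a set $P$ of states if, whenever $p\in P$ and $p\stackrel{\varepsilon}{\Rightarrow}p'$, there is $\mu\in X$ with $p'\stackrel{\mu}{\Rightarrow}$. Write $p\preccurlyeq_{\mathsf{MS}}q$ if, for every trace $s$, (i) $p\Downarrow s$ implies $q\Downarrow s$, and (ii) if $p\Downarrow s$, then every finite must-set of $\{p'\mid p\stackrel{s}{\Rightarrow}p'\}$ is a must-set of $\{q'\mid q\stackrel{s}{\Rightarrow}q'\}$. The two states may belong to different LTSs. For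 an LTS $\mathcal L$, the states of $\mathsf{FW}(\mathcal L)$ are the pairs $p\triangleright M$ of a state $p$ and a finite multiset $M$ of outputs, and its transitions are: $p\triangleright M\xrightarrow{\alpha}p'\triangleright M$ if $p\xrightarrow{\alpha}p'$; $p\triangleright(\{\!|\bar a|\!\}\uplus M)\xrightarrow{\tau}p'\triangleright M$ if $p\xrightarrow{a}p'$; $p\triangleright(\{\!|\bar a|\!\}\uplus M)\xrightarrow{\bar a}p\triangleright M$; and $p\triangleright M\xrightarrow{a}p\triangleright(\{\!|\bar a|\!\}\uplus M)$. Write $\mathsf{FW}(p)$ for the state $p\triangleright\varnothing$ of $\mathsf{FW}(\mathcal L)$. **Theorem.** Let $\mathcal L_A,\mathcal L_B\in\mathsf{Fdb}$, where $\mathcal L_A$ is image-finite (each state has finitely many successors for each action). Then for all states $p$ of $\mathcal L_A$ and $q$ of $\mathcal L_B$, $$p\sqsubseteq_{\mathrm{must}}q\quad\text{iff}\quad\mathsf{FW}(p)\preccurlyeq_{\mathsf{MS}}\mathsf{FW}(q).$$ This holds both 1. when clients range over the states of all client LTSs, and 2. when clients range over the states of one fixed client LTS that can express the following tests: there are functions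 $t$ from traces to clients, and $t'_E$ from traces to clients for each finite $E\subseteq\mathcal N$, such that each $f\in\{t\}\cup\{t'_E\}$ satisfies, for all traces $s$: $f(s)$ is not good; $f(\mu.s)\xrightarrow{\bar\mu}\simeq f(s)$; $f(\bar a.s)$ has a $\tau$-transition, and all its $\tau$-transitions lead to good states; the only possible visible transition of $f(\bar a.s)$ is $f(\bar a.s)\xrightarrow{a}f(s)$. Moreover $t(\varepsilon)$ has no visible transition, has a $\tau$-transition, and all its $\tau$-transitions lead to good states; $t'_E(\varepsilon)$ has no $\tau$-transition and no output, has an input transition $a$ exactly when $a\in E$, and all its visible transitions lead to good states. -/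

import Mathlib

universe u v w x t

namespace MustTesting

/-! ### Actions and labelled transition systems -/

/-- Visible actions over a set `N` of names: inputs `a` and outputs `ā`. -/
inductive VisAct (N : Type u) : Type u
  | inp (a : N) : VisAct N
  | out (a : N) : VisAct N

/-- Complementation of visible actions. -/
def VisAct.co {N : Type u} : VisAct N → VisAct N
  | .inp a => .out a
  | .out a => .inp a

/-- All actions: the visible ones and the invisible action `τ`. -/
inductive Act (N : Type u) : Type u
  | vis (μ : VisAct N) : Act N
  | tau : Act N

/-- The input action `a`. -/
abbrev Act.inp {N : Type u} (a : N) : Act N := .vis (.inp a)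

/-- The output action `ā`. -/
abbrev Act.out {N : Type u} (a : N) : Act N := .vis (.out a)

/-- A labelled transition system with states `S` and labels `Act N`. -/
structure LTS (N : Type u) (S : Type v) where
  tr : S → Act N → S → Prop

/-- LTSs of output-buffered agents with feedback, modulo an equivalence `≃` on states that is
compatible with transitions (`≃` may be equality). -/
structure FdbLTS (N : Type u) (S : Type v) extends LTS N S where
  /-- the equivalence `≃` -/
  eqv : S → S → Prop
  eqv_equivalence : Equivalence eqv
  /-- `≃` is compatible with transitions -/
  eqv_compat : ∀ {p q q' : S} {α : Act N}, eqv p q → tr q α q' → ∃ p', tr p α p' ∧ eqv p' q'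
  output_commutativity : ∀ {p p' q : S} {a : N} {α : Act N},
    tr p (.out a) p' → tr p' α q → ∃ p'' q', tr p α p'' ∧ tr p'' (.out a) q' ∧ eqv q' q
  feedback : ∀ {p p' q : S} {a : N},
    tr p (.out a) p' → tr p' (.inp a) q → ∃ q', tr p .tau q' ∧ eqv q' q
  output_confluence : ∀ {p p' p'' : S} {a : N} {μ : VisAct N}, μ ≠ .out a →
    tr p (.out a) p' → tr p (.vis μ) p'' →
      ∃ q q', tr p' (.vis μ) q ∧ tr p'' (.out a) q' ∧ eqv q' q
  output_determinacy : ∀ {p p' p'' : S} {a : N},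
    tr p (.out a) p' → tr p (.out a) p'' → eqv p' p''
  output_tau : ∀ {p p' p'' : S} {a : N}, tr p (.out a) p' → tr p .tau p'' →
    (∃ q q', tr p' .tau q ∧ tr p'' (.out a) q' ∧ eqv q' q) ∨
      (∃ q, tr p' (.inp a) q ∧ eqv q p'')
  backward_output_determinacy : ∀ {p' p'' q' q'' : S} {a : N},
    tr p' (.out a) q' → tr p'' (.out a) q'' → eqv q' q'' → eqv p' p''
  /-- The outputs a state can perform form a finite multiset (of names, each name `a` standing
  for the output `ā`). In particular the set of outputs of every state is finite. -/
  exists_mbox : ∃ mbox : S → Multiset N,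
    (∀ p a, a ∈ mbox p ↔ ∃ p', tr p (.out a) p') ∧
    (∀ p a p', tr p (.out a) p' → mbox p = a ::ₘ mbox p')

/-- An LTS of clients: output-buffered agents with feedback together with a predicate `good`
that is invariant under outputs and preserved by the equivalence of states. -/
structure ClientLTS (N : Type u) (C : Type v) extends FdbLTS N C where
  good : C → Prop
  good_output : ∀ {r r' : C} {a : N}, tr r (.out a) r' → (good r ↔ good r')
  good_eqv : ∀ {r r' : C}, eqv r r' → (good r ↔ good r')

/-- For each action, every state has finitely many successors. -/
def LTS.ImageFinite {N : Type u} {S : Type v} (L : LTS N S) : Prop :=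
  ∀ (p : S) (α : Act N), {p' | L.tr p α p'}.Finite

/-! ### Computations of a state transition system -/

/-- `f 0, f 1, …` is a reduction sequence from `s` with `len` steps (`len = ⊤`: infinite).
Only the values `f n` with `n ≤ len` matter. -/
def IsComputation {S : Type v} (red : S → S → Prop) (s : S) (len : ℕ∞) (f : ℕ → S) : Prop :=
  f 0 = s ∧ ∀ n : ℕ, (n : ℕ∞) < len → red (f n) (f (n + 1))

/-- The sequence is infinite or it cannot be extended. -/
def IsMaximal {S : Type v} (red : S → S → Prop) (len : ℕ∞) (f : ℕ → S) : Prop :=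
  ∀ n : ℕ, len = n → ¬ ∃ s', red (f n) s'

/-! ### Client-server systems and the must-preorder -/

/-- Reductions of client-server systems `p ▯ r`. -/
inductive SysStep {N : Type u} {S : Type v} {C : Type w} (L : LTS N S) (K : LTS N C) :
    S × C → S × C → Prop
  | srv {p p' : S} {r : C} : L.tr p .tau p' → SysStep L K (p, r) (p', r)
  | clt {p : S} {r r' : C} : K.tr r .tau r' → SysStep L K (p, r) (p, r')
  | com {p p' : S} {r r' : C} {μ : VisAct N} :
      L.tr p (.vis μ) p' → K.tr r (.vis μ.co) r' → SysStep L K (p, r) (p', r')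

/-- Client satisfaction: every maximal computation of `p ▯ r` is successful. -/
def Must {N : Type u} {S : Type v} {C : Type w} (L : LTS N S) (K : ClientLTS N C)
    (p : S) (r : C) : Prop :=
  ∀ (len : ℕ∞) (f : ℕ → S × C),
    IsComputation (SysStep L K.toLTS) (p, r) len f → IsMaximal (SysStep L K.toLTS) len f →
      ∃ n : ℕ, (n : ℕ∞) ≤ len ∧ K.good (f n).2

/-- The must-preorder `p ⊑ q` with clients taken from the client LTS `K`. -/
def MustLeqFor {N : Type u} {A : Type v} {B : Type w} {C : Type x} (LA : LTS N A) (LB : LTS N B)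
    (K : ClientLTS N C) (p : A) (q : B) : Prop :=
  ∀ r : C, Must LA K p r → Must LB K q r

/-- The must-preorder `p ⊑ q` with clients taken from all client LTSs. -/
def MustLeq {N : Type u} {A : Type v} {B : Type w}
    (LA : LTS N A) (LB : LTS N B) (p : A) (q : B) : Prop :=
  ∀ (C : Type t) (K : ClientLTS N C), MustLeqFor LA LB K p q

/-! ### Client generators -/

/-- Properties common to the generators of clients: `f s` offers the actions complementary to
those of the trace `s`, and can become `good` by a `τ`-step instead of performing an input. -/
structure GenSpec {N : Type u} {C : Type v} (K : ClientLTS N C)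
    (f : List (VisAct N) → C) : Prop where
  ungood : ∀ s, ¬ K.good (f s)
  step_co : ∀ μ s, ∃ r, K.tr (f (μ :: s)) (.vis μ.co) r ∧ K.eqv r (f s)
  out_tau : ∀ a s, ∃ r, K.tr (f (.out a :: s)) .tau r
  out_tau_good : ∀ a s r, K.tr (f (.out a :: s)) .tau r → K.good r
  out_vis : ∀ a s μ r, K.tr (f (.out a :: s)) (.vis μ) r → μ = .inp a ∧ r = f s

/-- `f` generates clients that test convergence along a trace. -/
structure ConvGenSpec {N : Type u} {C : Type v} (K : ClientLTS N C)
    (f : List (VisAct N) → C) : Prop extends GenSpec K f where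
  nil_vis : ∀ μ r, ¬ K.tr (f []) (.vis μ) r
  nil_tau : ∃ r, K.tr (f []) .tau r
  nil_tau_good : ∀ r, K.tr (f []) .tau r → K.good r

/-- `f` generates clients that test, after a trace, whether an output in a finite set is offered. -/
structure AccGenSpec {N : Type u} {C : Type v} (K : ClientLTS N C)
    (f : List (VisAct N) → Finset N → C) : Prop where
  gen : ∀ E, GenSpec K (fun s => f s E)
  nil_tau : ∀ E r, ¬ K.tr (f [] E) .tau r
  nil_out : ∀ E a r, ¬ K.tr (f [] E) (.out a) r
  nil_inp : ∀ E a, (∃ r, K.tr (f [] E) (.inp a) r) ↔ a ∈ E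
  nil_vis_good : ∀ E μ r, K.tr (f [] E) (.vis μ) r → K.good r

/-- The client LTS can express the tests for convergence and for acceptance sets. -/
def ClientLTS.HasGenerators {N : Type u} {C : Type v} (K : ClientLTS N C) : Prop :=
  (∃ f, ConvGenSpec K f) ∧ (∃ f, AccGenSpec K f)

/-! ### The must-set preorder -/

/-- Weak transitions `p ⇒ˢ p'`. -/
inductive LTS.Weak {N : Type u} {S : Type v} (L : LTS N S) : S → List (VisAct N) → S → Prop
  | refl (p : S) : Weak L p [] p
  | tau {p q p' : S} {s : List (VisAct N)} : L.tr p .tau q → Weak L q s p' → Weak L p s p'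
  | vis {p q p' : S} {μ : VisAct N} {s : List (VisAct N)} :
      L.tr p (.vis μ) q → Weak L q s p' → Weak L p (μ :: s) p'

/-- `p ↓`: every computation (sequence of `τ`-transitions) from `p` is finite. -/
def LTS.Converges {N : Type u} {S : Type v} (L : LTS N S) (p : S) : Prop :=
  ∀ (len : ℕ∞) (f : ℕ → S), IsComputation (fun x y => L.tr x .tau y) p len f → len ≠ ⊤

/-- `p ⇓ s`: convergence along a finite trace. -/
inductive LTS.ConvAlong {N : Type u} {S : Type v} (L : LTS N S) :
    S → List (VisAct N) → Prop
  | nil {p : S} : L.Converges p → ConvAlong L p []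
  | cons {p : S} {μ : VisAct N} {s : List (VisAct N)} : L.Converges p →
      (∀ p', L.Weak p [μ] p' → ConvAlong L p' s) → ConvAlong L p (μ :: s)

/-- The states reached from `p` by the trace `s`. -/
def LTS.after {N : Type u} {S : Type v} (L : LTS N S) (p : S) (s : List (VisAct N)) : Set S :=
  {p' | L.Weak p s p'}

/-- `X` is a must-set of every state in `P`. -/
def LTS.MustSet {N : Type u} {S : Type v} (L : LTS N S) (P : Set S) (X : Set (VisAct N)) : Prop :=
  ∀ p ∈ P, ∀ p', L.Weak p [] p' → ∃ μ ∈ X, ∃ p'', L.Weak p' [μ] p''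

/-- Inclusion of convergence along traces. -/
def CnvLeq {N : Type u} {A : Type v} {B : Type w} (LA : LTS N A) (LB : LTS N B)
    (p : A) (q : B) : Prop :=
  ∀ s, LA.ConvAlong p s → LB.ConvAlong q s

/-- Preservation of finite must-sets after convergent traces. -/
def MustSetsLeq {N : Type u} {A : Type v} {B : Type w} (LA : LTS N A) (LB : LTS N B)
    (p : A) (q : B) : Prop :=
  ∀ s, LA.ConvAlong p s → ∀ X : Set (VisAct N), X.Finite →
    LA.MustSet (LA.after p s) X → LB.MustSet (LB.after q s) X

/-- The must-set preorder `≼_MS`. -/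
def MSLeq {N : Type u} {A : Type v} {B : Type w} (LA : LTS N A) (LB : LTS N B)
    (p : A) (q : B) : Prop :=
  CnvLeq LA LB p q ∧ MustSetsLeq LA LB p q

/-! ### Lifting to forwarders -/

/-- The transitions of `FW(L)`. A mailbox is a finite multiset of outputs, represented by the
multiset of their names. -/
inductive FWStep {N : Type u} {S : Type v} (L : LTS N S) :
    S × Multiset N → Act N → S × Multiset N → Prop
  | proc {p p' : S} {M : Multiset N} {α : Act N} : L.tr p α p' → FWStep L (p, M) α (p', M)
  | comm {p p' : S} {M : Multiset N} {a : N} :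
      L.tr p (.inp a) p' → FWStep L (p, a ::ₘ M) .tau (p', M)
  | mout {p : S} {M : Multiset N} {a : N} : FWStep L (p, a ::ₘ M) (.out a) (p, M)
  | minp {p : S} {M : Multiset N} {a : N} : FWStep L (p, M) (.inp a) (p, a ::ₘ M)

/-- `FW(L)`, the lifting of `L` to an LTS with forwarding. -/
def LTS.FW {N : Type u} {S : Type v} (L : LTS N S) : LTS N (S × Multiset N) where
  tr := FWStep L

end MustTesting

open MustTesting

/-!
Everything is reduced to forwarders. Client satisfaction has an inductive form `MustInd`, and the
asynchrony axioms, which are needed for clients only, say that an output `ā` of a client can be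
moved into the mailbox of a forwarder without affecting satisfaction (`mustInd_fw_cons_iff`).
Moving all outputs of the client there shows that a server `p` and the forwarder `FW(p)` satisfy
the same clients (`mustInd_fw_iff`); the only new reductions are those that move outputs, and
there are finitely many of them in a row.

Soundness (`SetMSLeq.mustInd`) holds for any servers on the left that are image-finite with
finitely many outputs per state, and servers on the right that accept every input. The preorder is
generalized to a finite set `P` of states on the left, so that it is stable under the transitions
of the right-hand server `q`: when `q` performs `μ`, the set `P` is replaced by its weak
`μ`-derivatives. There are finitely many of these by convergence, and at least one since otherwise
`∅` would be a must-set. As `P` is finite, the largest rank of its members in the well-founded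
reduction order of unsuccessful computations drops at each move of the client
(`acc_finite_sets`), whereas the `τ`-steps of `q` in between terminate because `P` converges. The
system of `q` and a client that is not good can always reduce: the client has no output, as `q`
would accept it, and the outputs that the states reached from `P` can send to the client form a
finite must-set.

For completeness, the generated clients characterize the two halves of the preorder on forwarders:
passing the test `t(s)` is convergence along `s` (`ConvGenSpec.mustInd_fw_iff`), and passing
`t'_E(s)` is to have the outputs in `E` as a must-set after `s` (`AccGenSpec.mustInd_fw_iff`).
Sets of actions that contain an input are must-sets of all forwarders. At an input `a` of the trace
the behaviour of a generated client is not specified beyond an output `ā`, but that output can be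
moved into the mailbox, where the forwarder has performed the input `a`. For clients ranging over
all client LTSs, generators exist in an LTS of processes with output buffers
(`testLTS_hasGenerators`).
-/

namespace MustTesting

/-! ### Actions and weak transitions -/

theorem VisAct.co_co {N : Type u} (μ : VisAct N) : μ.co.co = μ := by
  cases μ <;> rfl

section Weak

variable {N : Type u} {S : Type v} {L : LTS N S}

theorem LTS.Weak.trans {p q q' : S} {s s' : List (VisAct N)} (h : L.Weak p s q)
    (h' : L.Weak q s' q') : L.Weak p (s ++ s') q' := by
  induction h with
  | refl => exact h'
  | tau h _ ih => exact .tau h (ih h')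
  | vis h _ ih => exact .vis h (ih h')

theorem LTS.Weak.single_vis {p q : S} {μ : VisAct N} (h : L.tr p (.vis μ) q) : L.Weak p [μ] q :=
  .vis h (.refl q)

theorem LTS.Weak.exists_cons {p q : S} {μ : VisAct N} {s : List (VisAct N)}
    (h : L.Weak p (μ :: s) q) : ∃ p', L.Weak p [μ] p' ∧ L.Weak p' s q := by
  generalize ht : μ :: s = t at h
  induction h with
  | refl => cases ht
  | tau h _ ih =>
    obtain ⟨p', h1, h2⟩ := ih ht
    exact ⟨p', .tau h h1, h2⟩
  | vis h h' _ =>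
    cases ht
    exact ⟨_, .single_vis h, h'⟩

/-- A weak visible transition of a `τ`-stable state starts with a strong one. -/
theorem LTS.Weak.exists_tr_of_stable {p q : S} {μ : VisAct N} (h : L.Weak p [μ] q)
    (hp : ∀ p', ¬ L.tr p .tau p') : ∃ p', L.tr p (.vis μ) p' := by
  cases h with
  | tau h _ => exact (hp _ h).elim
  | vis h _ => exact ⟨_, h⟩

theorem LTS.converges_iff_acc {p : S} :
    L.Converges p ↔ Acc (fun y x => L.tr x .tau y) p := by
  rw [← not_iff_not, not_acc_iff_exists_descending_chain]
  constructor
  · intro h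
    simp only [LTS.Converges, not_forall, not_not] at h
    obtain ⟨len, f, ⟨h0, hf⟩, rfl⟩ := h
    exact ⟨f, h0, fun n => hf n (ENat.natCast_lt_top n)⟩
  · rintro ⟨f, h0, hf⟩ h
    exact h ⊤ f ⟨h0, fun n _ => hf n⟩ rfl

theorem LTS.Converges.tau {p q : S} (h : L.Converges p) (hq : L.tr p .tau q) :
    L.Converges q :=
  L.converges_iff_acc.2 ((L.converges_iff_acc.1 h).inv hq)

theorem LTS.Converges.weak {p q : S} (h : L.Converges p) (hq : L.Weak p [] q) :
    L.Converges q := by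
  generalize ht : ([] : List (VisAct N)) = t at hq
  induction hq with
  | refl => exact h
  | tau h' _ ih => exact ih (h.tau h') ht
  | vis => cases ht

theorem LTS.Converges.exists_stable {p : S} (h : L.Converges p) :
    ∃ q, L.Weak p [] q ∧ ∀ q', ¬ L.tr q .tau q' := by
  replace h := L.converges_iff_acc.1 h
  induction h with
  | intro p _ ih =>
    by_cases hp : ∃ p', L.tr p .tau p'
    · obtain ⟨p', hp'⟩ := hp
      obtain ⟨q, hq, hs⟩ := ih p' hp'
      exact ⟨q, .tau hp' hq, hs⟩
    · exact ⟨p, .refl p, not_exists.1 hp⟩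

theorem LTS.ConvAlong.converges {p : S} {s : List (VisAct N)} (h : L.ConvAlong p s) :
    L.Converges p := by
  cases h <;> assumption

theorem LTS.ConvAlong.weak {p q : S} {μ : VisAct N} {s : List (VisAct N)}
    (h : L.ConvAlong p (μ :: s)) (hq : L.Weak p [μ] q) : L.ConvAlong q s := by
  cases h with
  | cons _ h => exact h q hq

theorem LTS.ConvAlong.tau {p q : S} {s : List (VisAct N)} (h : L.ConvAlong p s)
    (hq : L.tr p .tau q) : L.ConvAlong q s := by
  cases h with
  | nil h => exact .nil (h.tau hq)
  | cons h h' => exact .cons (h.tau hq) fun p' hp' => h' p' (.tau hq hp')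

theorem LTS.ImageFinite.finite_after_nil (hL : L.ImageFinite) {p : S} (h : L.Converges p) :
    (L.after p []).Finite := by
  replace h := L.converges_iff_acc.1 h
  induction h with
  | intro p _ ih =>
    refine ((Set.finite_singleton p).union ((hL p .tau).biUnion ih)).subset ?_
    intro q (hq : L.Weak p [] q)
    cases hq with
    | refl => exact .inl rfl
    | tau h h' => exact .inr (Set.mem_biUnion h h')

theorem LTS.ImageFinite.finite_after_single (hL : L.ImageFinite) {p : S} {μ : VisAct N}
    (h : L.ConvAlong p [μ]) : (L.after p [μ]).Finite := by
  have hacc := L.converges_iff_acc.1 h.converges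
  induction hacc with
  | intro p _ ih =>
    refine (((hL p .tau).biUnion fun q hq => ih q hq (h.tau hq)).union
      ((hL p (.vis μ)).biUnion fun q hq =>
        hL.finite_after_nil (h.weak (.single_vis hq)).converges)).subset ?_
    intro q (hq : L.Weak p [μ] q)
    cases hq with
    | tau h h' => exact .inl (Set.mem_biUnion h h')
    | vis h h' => exact .inr (Set.mem_biUnion h h')

end Weak

/-! ### Inductive client satisfaction -/

/-- Client satisfaction as a least fixed point: the client is good, or the system can reduce and
all its reducts satisfy the client. -/
inductive MustInd {N : Type u} {S : Type v} {C : Type w} (L : LTS N S) (K : ClientLTS N C) :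
    S → C → Prop
  | now {p : S} {r : C} : K.good r → MustInd L K p r
  | step {p : S} {r : C} : ¬ K.good r → (∃ y, SysStep L K.toLTS (p, r) y) →
      (∀ p' r', SysStep L K.toLTS (p, r) (p', r') → MustInd L K p' r') → MustInd L K p r

section Must

variable {N : Type u} {S : Type v} {C : Type w} {L : LTS N S} {K : ClientLTS N C}

theorem MustInd.exists_step {p : S} {r : C} (h : MustInd L K p r) (hr : ¬ K.good r) :
    ∃ y, SysStep L K.toLTS (p, r) y := by
  cases h with
  | now h => exact (hr h).elim
  | step _ h _ => exact h

theorem MustInd.next {p p' : S} {r r' : C} (h : MustInd L K p r) (hr : ¬ K.good r)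
    (hs : SysStep L K.toLTS (p, r) (p', r')) : MustInd L K p' r' := by
  cases h with
  | now h => exact (hr h).elim
  | step _ _ h => exact h _ _ hs

theorem MustInd.of_steps {p : S} {r : C}
    (hred : ¬ K.good r → ∃ y, SysStep L K.toLTS (p, r) y)
    (hsrv : ¬ K.good r → ∀ p', L.tr p .tau p' → MustInd L K p' r)
    (hclt : ¬ K.good r → ∀ r', K.tr r .tau r' → MustInd L K p r')
    (hcom : ¬ K.good r → ∀ μ p' r', L.tr p (.vis μ) p' → K.tr r (.vis μ.co) r' →
      MustInd L K p' r') : MustInd L K p r := by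
  by_cases hr : K.good r
  · exact .now hr
  · refine .step hr (hred hr) fun p' r' hs => ?_
    cases hs with
    | srv h => exact hsrv hr _ h
    | clt h => exact hclt hr _ h
    | com h h' => exact hcom hr _ _ _ h h'

theorem must_iff_mustInd {p : S} {r : C} : Must L K p r ↔ MustInd L K p r := by
  classical
  constructor
  · contrapose
    intro hpr hmust
    -- Follow reducts that violate `MustInd` for as long as there are any.
    let bad : S × C → S × C → Prop := fun x y => SysStep L K.toLTS x y ∧ ¬ MustInd L K y.1 y.2
    let next : S × C → S × C := fun x => if h : ∃ y, bad x y then h.choose else x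
    let f : ℕ → S × C := fun n => next^[n] (p, r)
    have hf : ∀ n, f (n + 1) = next (f n) := fun n => Function.iterate_succ_apply' next n _
    have hstep : ∀ n, (∃ y, bad (f n) y) → bad (f n) (f (n + 1)) := by
      intro n h
      rw [hf]
      simp only [next, dif_pos h]
      exact h.choose_spec
    have hbad : ∀ n, ¬ MustInd L K (f n).1 (f n).2 := by
      intro n
      induction n with
      | zero => exact hpr
      | succ n ih =>
        by_cases h : ∃ y, bad (f n) y
        · exact (hstep n h).2
        · rw [hf]
          simpa only [next, dif_neg h] using ih
    have hgood : ∀ n, ¬ K.good (f n).2 := fun n h => hbad n (.now h)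
    by_cases hinf : ∀ n, ∃ y, bad (f n) y
    · obtain ⟨n, _, hn⟩ := hmust ⊤ f ⟨rfl, fun n _ => (hstep n (hinf n)).1⟩
        (fun n hn => (ENat.natCast_ne_top n hn.symm).elim)
      exact hgood n hn
    · have hex : ∃ n, ¬ ∃ y, bad (f n) y := not_forall.1 hinf
      obtain ⟨n, _, hn⟩ := hmust (Nat.find hex : ℕ) f
        ⟨rfl, fun n hn => (hstep n (not_not.1 (Nat.find_min hex (by exact_mod_cast hn)))).1⟩
        (fun n hn hred => by
          have hn : Nat.find hex = n := by exact_mod_cast hn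
          subst hn
          refine hbad _ (.step (hgood _) hred fun p' r' hs => ?_)
          by_contra hc
          exact Nat.find_spec hex ⟨(p', r'), hs, hc⟩)
      exact hgood n hn
  · intro h len f ⟨h0, hf⟩ hmax
    suffices H : ∀ n : ℕ, (n : ℕ∞) ≤ len → f n = (p, r) →
        ∃ m : ℕ, (m : ℕ∞) ≤ len ∧ K.good (f m).2 from H 0 (by simp) h0
    clear h0
    induction h with
    | now h => exact fun n hn hfn => ⟨n, hn, by rwa [hfn]⟩
    | step _ hred _ ih =>
      intro n hn hfn
      rcases hn.lt_or_eq with hlt | heq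
      · have hs := hf n hlt
        rw [hfn] at hs
        exact ih (f (n + 1)).1 (f (n + 1)).2 hs (n + 1)
          (by exact_mod_cast Order.add_one_le_of_lt hlt) rfl
      · rw [← hfn] at hred
        exact (hmax n heq.symm hred).elim

theorem MustInd.eqv {p : S} {r r' : C} (h : MustInd L K p r) (hr : K.eqv r r') :
    MustInd L K p r' := by
  induction h generalizing r' with
  | now h => exact .now ((K.good_eqv hr).1 h)
  | @step p r _ hred hs ih =>
    refine .of_steps (fun _ => ?_) (fun _ p' h => ih _ _ (.srv h) hr)
      (fun _ r1' h => ?_) (fun _ μ p' r1' h h' => ?_)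
    · obtain ⟨y, hy⟩ := hred
      cases hy with
      | srv h => exact ⟨_, .srv h⟩
      | clt h =>
        obtain ⟨r1, h, -⟩ := K.eqv_compat (K.eqv_equivalence.symm hr) h
        exact ⟨_, .clt h⟩
      | com h h' =>
        obtain ⟨r1, h', -⟩ := K.eqv_compat (K.eqv_equivalence.symm hr) h'
        exact ⟨_, .com h h'⟩
    · obtain ⟨r1, h1, h2⟩ := K.eqv_compat hr h
      exact ih _ _ (.clt h1) h2
    · obtain ⟨r1, h1, h2⟩ := K.eqv_compat hr h'
      exact ih _ _ (.com h h1) h2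

theorem MustInd.converges {p : S} {r : C} (h : MustInd L K p r) (hr : ¬ K.good r) :
    L.Converges p := by
  rw [L.converges_iff_acc]
  induction h with
  | now h => exact (hr h).elim
  | step _ _ _ ih => exact ⟨_, fun p' h => ih _ _ (.srv h) hr⟩

end Must

/-! ### Moving outputs between the client and the mailbox -/

section Swap

variable {N : Type u} {S : Type v} {C : Type w} {L : LTS N S} {K : ClientLTS N C}

theorem FWStep.cons {p p' : S} {M M' : Multiset N} {α : Act N} (a : N)
    (h : FWStep L (p, M) α (p', M')) : FWStep L (p, a ::ₘ M) α (p', a ::ₘ M') := by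
  cases h with
  | proc h => exact .proc h
  | comm h => rw [Multiset.cons_swap]; exact .comm h
  | mout => rw [Multiset.cons_swap]; exact .mout
  | minp => rw [Multiset.cons_swap]; exact .minp

/-- An output of the client may equally well be held in the mailbox of the server: the asynchrony
axioms for clients say exactly that neither side can tell. -/
theorem mustInd_fw_cons_iff {p : S} {M : Multiset N} {r r' : C} {a : N}
    (hr : K.tr r (.out a) r') :
    MustInd L.FW K (p, a ::ₘ M) r' ↔ MustInd L.FW K (p, M) r := by
  constructor
  · intro h
    -- The axioms close diagrams only up to `≃`, so the induction has to absorb one.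
    suffices H : ∀ r₀, K.tr r (.out a) r₀ → K.eqv r₀ r' → MustInd L.FW K (p, M) r from
      H r' hr (K.eqv_equivalence.refl r')
    clear hr
    generalize hx : (p, a ::ₘ M) = x at h
    induction h generalizing p M r with
    | now h => exact fun r₀ hr he => .now ((K.good_output hr).2 ((K.good_eqv he).2 h))
    | @step x r' hg hred hs ih =>
      subst hx
      intro r₀ hr he
      have he' := K.eqv_equivalence.symm he
      refine .of_steps (fun _ => ⟨_, .com (μ := .inp a) .minp hr⟩)
        (fun _ ⟨p1, M1⟩ h => ih _ _ (.srv (FWStep.cons a h)) rfl r₀ hr he) ?_ ?_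
      · intro _ r1 h
        rcases K.output_tau hr h with ⟨s1, r2, h1, h2, h3⟩ | ⟨s1, h1, h2⟩
        · obtain ⟨s2, h4, h5⟩ := K.eqv_compat he' h1
          exact ih _ _ (.clt h4) rfl r2 h2
            (K.eqv_equivalence.trans h3 (K.eqv_equivalence.symm h5))
        · obtain ⟨s2, h4, h5⟩ := K.eqv_compat he' h1
          exact (hs _ _ (.com (μ := .out a) .mout h4)).eqv (K.eqv_equivalence.trans h5 h2)
      · rintro _ μ ⟨p1, M1⟩ r1 h h'
        by_cases hμ : μ.co = .out a
        · have hμ' : μ = .inp a := by rw [← μ.co_co, hμ]; rfl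
          subst hμ'
          have he1 : K.eqv r' r1 := K.eqv_equivalence.trans he' (K.output_determinacy hr h')
          cases h with
          | proc h => exact (hs _ _ (.srv (.comm h))).eqv he1
          | minp => exact MustInd.eqv (.step hg hred hs) he1
        · obtain ⟨s1, r2, h1, h2, h3⟩ := K.output_confluence hμ hr h'
          obtain ⟨s2, h4, h5⟩ := K.eqv_compat he' h1
          exact ih _ _ (.com (FWStep.cons a h) h4) rfl r2 h2
            (K.eqv_equivalence.trans h3 (K.eqv_equivalence.symm h5))
  · intro h
    by_cases hg : K.good r
    · exact .now ((K.good_output hr).1 hg)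
    · exact h.next hg (.com (μ := .inp a) .minp hr)

end Swap

/-! ### Lifting servers to forwarders -/

/-- `r` becomes `r'`, up to `≃`, by performing the outputs in `M` in some order. -/
inductive Outs {N : Type u} {C : Type w} (K : FdbLTS N C) : C → Multiset N → C → Prop
  | nil {r r' : C} : K.eqv r r' → Outs K r 0 r'
  | cons {r r₁ r' : C} {a : N} {M : Multiset N} :
      K.tr r (.out a) r₁ → Outs K r₁ M r' → Outs K r (a ::ₘ M) r'

section Outs

variable {N : Type u} {C : Type w} {K : FdbLTS N C}

theorem Outs.eqv_left {r s r' : C} {M : Multiset N} (h : Outs K r M r') (hs : K.eqv s r) :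
    Outs K s M r' := by
  induction h generalizing s with
  | nil h => exact .nil (K.eqv_equivalence.trans hs h)
  | cons h _ ih =>
    obtain ⟨s1, h1, h2⟩ := K.eqv_compat hs h
    exact .cons h1 (ih h2)

theorem Outs.exists_tr_out {r r' : C} {M : Multiset N} {a : N} (h : Outs K r (a ::ₘ M) r') :
    ∃ r₁, K.tr r (.out a) r₁ ∧ Outs K r₁ M r' := by
  generalize hM : a ::ₘ M = M₀ at h
  induction h generalizing M with
  | nil => simp at hM
  | @cons r r₁ r' b M₁ h h' ih =>
    rcases Multiset.cons_eq_cons.1 hM with ⟨rfl, rfl⟩ | ⟨_, M₂, rfl, rfl⟩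
    · exact ⟨r₁, h, h'⟩
    · obtain ⟨r₂, h1, h2⟩ := ih rfl
      obtain ⟨s, s', h3, h4, h5⟩ := K.output_commutativity h h1
      exact ⟨s, h3, .cons h4 (h2.eqv_left h5)⟩

theorem Outs.exists_tr {r r' r'' : C} {M : Multiset N} {α : Act N} (h : Outs K r M r')
    (h' : K.tr r' α r'') : ∃ r₁, K.tr r α r₁ ∧ Outs K r₁ M r'' := by
  induction h with
  | nil h =>
    obtain ⟨s, h1, h2⟩ := K.eqv_compat h h'
    exact ⟨s, h1, .nil h2⟩
  | cons h _ ih =>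
    obtain ⟨s, h1, h2⟩ := ih h'
    obtain ⟨t, t', h3, h4, h5⟩ := K.output_commutativity h h1
    exact ⟨t, h3, .cons h4 (h2.eqv_left h5)⟩

theorem Outs.exists_tau {r r' r'' : C} {M : Multiset N} {a : N} (h : Outs K r (a ::ₘ M) r')
    (h' : K.tr r' (.inp a) r'') : ∃ r₁, K.tr r .tau r₁ ∧ Outs K r₁ M r'' := by
  obtain ⟨r₁, h1, h2⟩ := h.exists_tr_out
  obtain ⟨r₂, h3, h4⟩ := h2.exists_tr h'
  obtain ⟨r₃, h5, h6⟩ := K.feedback h1 h3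
  exact ⟨r₃, h5, h4.eqv_left h6⟩

theorem Outs.out_or_vis {r r' r₁ : C} {M : Multiset N} {μ : VisAct N} (h : Outs K r M r')
    (h' : K.tr r (.vis μ) r₁) : (∃ a ∈ M, μ = .out a) ∨ ∃ s, K.tr r' (.vis μ) s := by
  induction h generalizing r₁ with
  | nil h =>
    obtain ⟨s, h1, -⟩ := K.eqv_compat (K.eqv_equivalence.symm h) h'
    exact .inr ⟨s, h1⟩
  | @cons r _ r' a M h _ ih =>
    by_cases hμ : μ = .out a
    · exact .inl ⟨a, Multiset.mem_cons_self a M, hμ⟩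
    · obtain ⟨s, s', h1, -, -⟩ := K.output_confluence hμ h h'
      rcases ih h1 with ⟨b, hb, rfl⟩ | h
      · exact .inl ⟨b, Multiset.mem_cons_of_mem hb, rfl⟩
      · exact .inr h

theorem Outs.tau_or_inp {r r' r₁ : C} {M : Multiset N} (h : Outs K r M r')
    (h' : K.tr r .tau r₁) : (∃ s, K.tr r' .tau s) ∨ ∃ a ∈ M, ∃ s, K.tr r' (.inp a) s := by
  induction h generalizing r₁ with
  | nil h =>
    obtain ⟨s, h1, -⟩ := K.eqv_compat (K.eqv_equivalence.symm h) h'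
    exact .inl ⟨s, h1⟩
  | @cons r _ r' a M h h'' ih =>
    rcases K.output_tau h h' with ⟨s, s', h1, -, -⟩ | ⟨s, h1, -⟩
    · rcases ih h1 with h | ⟨b, hb, h⟩
      · exact .inl h
      · exact .inr ⟨b, Multiset.mem_cons_of_mem hb, h⟩
    · rcases h''.out_or_vis h1 with ⟨b, _, hb⟩ | h
      · cases hb
      · exact .inr ⟨a, Multiset.mem_cons_self a M, h⟩

theorem exists_outs_stable (K : FdbLTS N C) (r : C) :
    ∃ M r', Outs K r M r' ∧ ∀ a r'', ¬ K.tr r' (.out a) r'' := by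
  obtain ⟨mbox, hmem, hcons⟩ := K.exists_mbox
  generalize hm : mbox r = m
  induction m using Multiset.induction generalizing r with
  | empty =>
    refine ⟨0, r, .nil (K.eqv_equivalence.refl r), fun a r'' h => ?_⟩
    have := (hmem r a).2 ⟨r'', h⟩
    simp [hm] at this
  | cons a m ih =>
    obtain ⟨r₁, h₁⟩ := (hmem r a).1 (by simp [hm])
    obtain ⟨M, r', h2, h3⟩ := ih r₁ (by
      have := hcons r a r₁ h₁
      rw [hm] at this
      exact ((Multiset.cons_inj_right a).1 this).symm)
    exact ⟨a ::ₘ M, r', .cons h₁ h2, h3⟩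

end Outs

section Lift

variable {N : Type u} {S : Type v} {C : Type w} {L : LTS N S} {K : ClientLTS N C}

theorem mustInd_fw_outs_iff {p : S} {M M' : Multiset N} {r r' : C}
    (h : Outs K.toFdbLTS r M r') :
    MustInd L.FW K (p, M + M') r' ↔ MustInd L.FW K (p, M') r := by
  induction h generalizing M' with
  | nil h =>
    rw [zero_add]
    exact ⟨fun hm => hm.eqv (K.eqv_equivalence.symm h), fun hm => hm.eqv h⟩
  | cons h _ ih => rw [← mustInd_fw_cons_iff h, ← ih, Multiset.add_cons, Multiset.cons_add]

theorem FWStep.empty {p p' : S} {α : Act N} (h : L.tr p α p') : L.FW.tr (p, 0) α (p', 0) :=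
  .proc h

/-- When the mailbox holds all outputs of the client, no reduction merely moves an output into it.
So the system with the forwarder can reduce exactly if the original one can. -/
theorem exists_step_iff_of_outs {p : S} {M : Multiset N} {r r' : C}
    (h : Outs K.toFdbLTS r M r') (hr' : ∀ a r'', ¬ K.tr r' (.out a) r'') :
    (∃ y, SysStep L K.toLTS (p, r) y) ↔ ∃ y, SysStep L.FW K.toLTS ((p, M), r') y := by
  constructor
  · rintro ⟨_, hs⟩
    cases hs with
    | srv h1 => exact ⟨_, .srv (.proc h1)⟩
    | clt h1 =>
      rcases h.tau_or_inp h1 with ⟨s, h2⟩ | ⟨a, ha, s, h2⟩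
      · exact ⟨_, .clt h2⟩
      · obtain ⟨M, rfl⟩ := Multiset.exists_cons_of_mem ha
        exact ⟨_, .com (μ := .out a) .mout h2⟩
    | @com _ _ _ _ μ h1 h2 =>
      rcases h.out_or_vis h2 with ⟨a, ha, hμ⟩ | ⟨s, h3⟩
      · obtain ⟨M, rfl⟩ := Multiset.exists_cons_of_mem ha
        have hμ' : μ = .inp a := by rw [← μ.co_co, hμ]; rfl
        subst hμ'
        exact ⟨_, .srv (.comm h1)⟩
      · exact ⟨_, .com (.proc h1) h3⟩
  · rintro ⟨_, hs⟩
    cases hs with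
    | srv h1 =>
      cases h1 with
      | proc h1 => exact ⟨_, .srv h1⟩
      | @comm _ _ _ a h1 =>
        obtain ⟨r₁, h2, -⟩ := h.exists_tr_out
        exact ⟨_, .com (μ := .inp a) h1 h2⟩
    | clt h1 =>
      obtain ⟨r₁, h2, -⟩ := h.exists_tr h1
      exact ⟨_, .clt h2⟩
    | com h1 h2 =>
      cases h1 with
      | proc h1 =>
        obtain ⟨r₁, h3, -⟩ := h.exists_tr h2
        exact ⟨_, .com h1 h3⟩
      | mout =>
        obtain ⟨r₁, h3, -⟩ := h.exists_tau h2
        exact ⟨_, .clt h3⟩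
      | minp => exact (hr' _ _ h2).elim

theorem mustInd_fw_iff {p : S} {r : C} : MustInd L.FW K (p, 0) r ↔ MustInd L K p r := by
  constructor
  · intro h
    generalize hx : (p, (0 : Multiset N)) = x at h
    induction h generalizing p with
    | now h => exact .now h
    | @step x r hg hred hs ih =>
      subst hx
      obtain ⟨M, r', ho, hr'⟩ := exists_outs_stable K.toFdbLTS r
      refine .of_steps (fun _ => ?_) (fun _ p' h => ih _ _ (.srv (.empty h)) rfl)
        (fun _ r' h => ih _ _ (.clt h) rfl)
        (fun _ μ p' r' h h' => ih _ _ (.com (.empty h) h') rfl)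
      rw [exists_step_iff_of_outs ho hr']
      have hm : MustInd L.FW K (p, M + 0) r' := (mustInd_fw_outs_iff ho).2 (.step hg hred hs)
      rw [add_zero] at hm
      exact hm.exists_step fun h => hg (by
        clear * - h ho
        induction ho with
        | nil he => exact (K.good_eqv he).2 h
        | cons ht _ ih => exact (K.good_output ht).2 (ih h))
  · intro h
    induction h with
    | now h => exact .now h
    | @step p r hg hred hs ih =>
      -- It suffices to consider the system in which all outputs of the client are buffered: it
      -- has no reductions that only move an output into the mailbox.
      obtain ⟨M, r', ho, hr'⟩ := exists_outs_stable K.toFdbLTS r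
      rw [← mustInd_fw_outs_iff ho, add_zero]
      have aux : ∀ {p' r₀ M' r''}, Outs K.toFdbLTS r₀ M' r'' →
          SysStep L K.toLTS (p, r) (p', r₀) → MustInd L.FW K (p', M') r'' := by
        intro p' r₀ M' r'' h1 h2
        have := (mustInd_fw_outs_iff h1).2 (ih _ _ h2)
        rwa [add_zero] at this
      refine .of_steps (fun _ => (exists_step_iff_of_outs ho hr').1 hred) ?_ ?_ ?_
      · rintro _ ⟨p', M'⟩ h1
        cases h1 with
        | proc h1 => exact aux ho (.srv h1)
        | @comm _ _ _ a h1 =>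
          obtain ⟨r₁, h2, h3⟩ := ho.exists_tr_out
          exact aux h3 (.com (μ := .inp a) h1 h2)
      · intro _ r'' h1
        obtain ⟨r₁, h2, h3⟩ := ho.exists_tr h1
        exact aux h3 (.clt h2)
      · rintro _ μ ⟨p', M'⟩ r'' h1 h2
        cases h1 with
        | proc h1 =>
          obtain ⟨r₁, h3, h4⟩ := ho.exists_tr h2
          exact aux h4 (.com h1 h3)
        | mout =>
          obtain ⟨r₁, h3, h4⟩ := ho.exists_tau h2
          exact aux h4 (.clt h3)
        | minp => exact (hr' _ _ h2).elim

theorem must_iff_mustInd_fw {p : S} {r : C} : Must L K p r ↔ MustInd L.FW K (p, 0) r :=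
  must_iff_mustInd.trans mustInd_fw_iff.symm

theorem LTS.ImageFinite.fw (hL : L.ImageFinite) : L.FW.ImageFinite := by
  classical
  rintro ⟨p, M⟩ α
  have hM : {a | a ∈ M}.Finite := M.finite_toSet
  have hinp : {x : S × Multiset N | ∃ a, α = .inp a ∧ x = (p, a ::ₘ M)}.Finite := by
    refine Set.Subsingleton.finite ?_
    rintro _ ⟨a, rfl, rfl⟩ _ ⟨b, h, rfl⟩
    cases h
    rfl
  refine ((((hL p α).image (·, M)).union (hM.biUnion fun a _ =>
    (hL p (.inp a)).image (·, M.erase a))).union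
      ((hM.image fun a => (p, M.erase a)).union hinp)).subset ?_
  intro y hy
  cases (hy : FWStep L (p, M) α y) with
  | proc h => exact .inl (.inl ⟨_, h, rfl⟩)
  | @comm _ _ M a h =>
    exact .inl (.inr (Set.mem_biUnion (Multiset.mem_cons_self a M) ⟨_, h, by simp⟩))
  | @mout _ M a => exact .inr (.inl ⟨a, Multiset.mem_cons_self a M, by simp⟩)
  | @minp _ M a => exact .inr (.inr ⟨a, rfl, rfl⟩)

theorem FdbLTS.finite_outputs_fw (L : FdbLTS N S) (x : S × Multiset N) :
    {a | ∃ y, L.FW.tr x (.out a) y}.Finite := by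
  obtain ⟨mbox, hmem, -⟩ := L.exists_mbox
  obtain ⟨p, M⟩ := x
  refine ((mbox p).finite_toSet.union M.finite_toSet).subset ?_
  rintro a ⟨y, hy⟩
  cases (hy : FWStep _ (p, M) (.out a) y) with
  | proc h => exact .inl ((hmem p a).2 ⟨_, h⟩)
  | mout => exact .inr (Multiset.mem_cons_self _ _)

end Lift

/-! ### Soundness of the must-set preorder -/

/-- A step between finite nonempty sets under which every new element descends from an old one is
well founded on sets of accessible points: the largest rank of an element decreases. This is where
finiteness replaces a use of König's lemma. -/
theorem acc_finite_sets {α : Type u} {R : α → α → Prop} {Q : Set α} (hfin : Q.Finite)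
    (hQ : ∀ x ∈ Q, Acc R x) :
    Acc (fun Q' Q : Set α => Q'.Finite ∧ Q'.Nonempty ∧ ∀ y ∈ Q', ∃ x ∈ Q, R y x) Q := by
  classical
  let rk : α → Ordinal.{u} := fun x => if h : Acc R x then h.rank else 0
  have hrk : ∀ {x y}, Acc R x → R y x → rk y < rk x := by
    intro x y hx hy
    simp only [rk, dif_pos hx, dif_pos (hx.inv hy)]
    exact Acc.rank_lt_of_rel hx hy
  have H : ∀ (κ : Ordinal.{u}) (Q : Set α), (∀ x ∈ Q, Acc R x ∧ rk x ≤ κ) →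
      Acc (fun Q' Q : Set α => Q'.Finite ∧ Q'.Nonempty ∧ ∀ y ∈ Q', ∃ x ∈ Q, R y x) Q := by
    intro κ
    induction κ using WellFoundedLT.induction with
    | ind κ ih =>
      refine fun Q hQ => ⟨_, ?_⟩
      rintro Q' ⟨hfin', hne', hd⟩
      obtain ⟨y, hy, hmax⟩ := Set.exists_max_image Q' rk hfin' hne'
      obtain ⟨x, hx, hyx⟩ := hd y hy
      refine ih (rk y) ((hrk (hQ x hx).1 hyx).trans_le (hQ x hx).2) Q' fun z hz => ?_
      obtain ⟨x', hx', hzx⟩ := hd z hz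
      exact ⟨(hQ x' hx').1.inv hzx, hmax z hz⟩
  rcases Q.eq_empty_or_nonempty with rfl | hne
  · exact H 0 ∅ (by simp)
  · obtain ⟨x, hx, hmax⟩ := Set.exists_max_image Q rk hfin hne
    exact H (rk x) Q fun z hz => ⟨hQ z hz, hmax z hz⟩

section Sound

variable {N : Type u} {A : Type v} {B : Type w} {C : Type x} {LA : LTS N A} {LB : LTS N B}
  {K : ClientLTS N C}

/-- The reductions of systems whose client is not good, as a relation from reduct to redex. -/
def UngoodStep (LA : LTS N A) (K : ClientLTS N C) (y x : A × C) : Prop :=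
  ¬ K.good x.2 ∧ SysStep LA K.toLTS x y

theorem MustInd.acc {p : A} {r : C} (h : MustInd LA K p r) : Acc (UngoodStep LA K) (p, r) := by
  induction h with
  | now h => exact ⟨_, fun y hy => (hy.1 h).elim⟩
  | step _ _ _ ih => exact ⟨_, fun y hy => ih y.1 y.2 hy.2⟩

theorem MustInd.of_reflTransGen {x y : A × C} (h : MustInd LA K x.1 x.2)
    (hy : Relation.ReflTransGen (UngoodStep LA K) y x) : MustInd LA K y.1 y.2 := by
  induction hy with
  | refl => exact h
  | tail _ h' ih => exact ih (h.next h'.1 h'.2)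

theorem LTS.Weak.reflTransGen {p p' : A} {r : C} (hr : ¬ K.good r) (h : LA.Weak p [] p') :
    Relation.ReflTransGen (UngoodStep LA K) (p', r) (p, r) := by
  generalize ht : ([] : List (VisAct N)) = t at h
  induction h with
  | refl => exact .refl
  | tau h _ ih => exact (ih ht).tail ⟨hr, .srv h⟩
  | vis => cases ht

theorem LTS.Weak.transGen {p p' : A} {r r' : C} {μ : VisAct N} (hr : ¬ K.good r)
    (hr' : ¬ K.good r') (h : LA.Weak p [μ] p') (hμ : K.tr r (.vis μ.co) r') :
    Relation.TransGen (UngoodStep LA K) (p', r') (p, r) := by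
  generalize ht : [μ] = t at h
  induction h with
  | refl => cases ht
  | tau h _ ih => exact (ih ht).tail ⟨hr, .srv h⟩
  | vis h h' =>
    cases ht
    exact .tail' (h'.reflTransGen hr') ⟨hr, .com h hμ⟩

/-- The must-set preorder between a set of states on the left and a state on the right: on the
left, properties are required of all states of the set. -/
def SetMSLeq (LA : LTS N A) (LB : LTS N B) (P : Set A) (q : B) : Prop :=
  ∀ s, (∀ p ∈ P, LA.ConvAlong p s) → LB.ConvAlong q s ∧
    ∀ X : Set (VisAct N), X.Finite → (∀ p ∈ P, LA.MustSet (LA.after p s) X) →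
      LB.MustSet (LB.after q s) X

theorem MSLeq.singleton {p : A} {q : B} (h : MSLeq LA LB p q) : SetMSLeq LA LB {p} q :=
  fun s hs => ⟨h.1 s (hs p rfl), fun X hX hp => h.2 s (hs p rfl) X hX (hp p rfl)⟩

theorem SetMSLeq.tau {P : Set A} {q q' : B} (h : SetMSLeq LA LB P q) (hq : LB.tr q .tau q') :
    SetMSLeq LA LB P q' :=
  fun s hs => ⟨(h s hs).1.tau hq, fun X hX hP q₁ h₁ => (h s hs).2 X hX hP q₁ (.tau hq h₁)⟩

theorem SetMSLeq.vis {P : Set A} {q q' : B} {μ : VisAct N} (h : SetMSLeq LA LB P q)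
    (hP : ∀ p ∈ P, LA.Converges p) (hq : LB.tr q (.vis μ) q') :
    SetMSLeq LA LB {p' | ∃ p ∈ P, LA.Weak p [μ] p'} q' := by
  intro s hs
  have hc := h (μ :: s) fun p hp => .cons (hP p hp) fun p' hp' => hs p' ⟨p, hp, hp'⟩
  refine ⟨hc.1.weak (.single_vis hq), fun X hX hX' q₁ h₁ => hc.2 X hX ?_ q₁ (.vis hq h₁)⟩
  intro p hp p'' hp''
  obtain ⟨p', h1, h2⟩ := LTS.Weak.exists_cons hp''
  exact hX' p' ⟨p, hp, h1⟩ p'' h2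

/-- If `P` were empty, then the empty set would be a must-set on the left. -/
theorem SetMSLeq.nonempty {P : Set A} {q : B} (h : SetMSLeq LA LB P q) : P.Nonempty := by
  by_contra hP
  rw [Set.not_nonempty_iff_eq_empty] at hP
  subst hP
  obtain ⟨μ, hμ, -⟩ := (h [] (by simp)).2 ∅ Set.finite_empty (by simp) q (.refl q) q (.refl q)
  exact hμ

/-- The outputs that some state in `P` can reach and the client can consume form a finite must-set
of `P`, so a stable server on the right has to offer one of them. -/
theorem SetMSLeq.exists_step (hA : LA.ImageFinite)
    (hout : ∀ p, {a | ∃ p', LA.tr p (.out a) p'}.Finite)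
    (hinp : ∀ q a, ∃ q', LB.tr q (.inp a) q')
    {P : Set A} {q : B} {r : C} (hr : ¬ K.good r) (hfin : P.Finite)
    (hm : ∀ p ∈ P, MustInd LA K p r) (h : SetMSLeq LA LB P q) :
    ∃ y, SysStep LB K.toLTS (q, r) y := by
  by_contra hstuck
  have hq : ∀ q', ¬ LB.tr q .tau q' := fun q' h => hstuck ⟨_, .srv h⟩
  have hrτ : ∀ r', ¬ K.tr r .tau r' := fun r' h => hstuck ⟨_, .clt h⟩
  have hrout : ∀ a r', ¬ K.tr r (.out a) r' := fun a r' h => by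
    obtain ⟨q', hq'⟩ := hinp q a
    exact hstuck ⟨_, .com (μ := .inp a) hq' h⟩
  have hconv : ∀ p ∈ P, LA.Converges p := fun p hp => (hm p hp).converges hr
  let Y : Set N := {a | (∃ r', K.tr r (.inp a) r') ∧
    ∃ p ∈ P, ∃ p' ∈ LA.after p [], ∃ p'', LA.tr p' (.out a) p''}
  have hY : Y.Finite := by
    refine (hfin.biUnion fun p hp => (hA.finite_after_nil (hconv p hp)).biUnion
      fun p' _ => hout p').subset ?_
    rintro a ⟨-, p, hp, p', hp', h⟩
    exact Set.mem_biUnion hp (Set.mem_biUnion hp' h)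
  have hmust := (h [] fun p hp => .nil (hconv p hp)).2 (VisAct.out '' Y) (hY.image _) ?_
    q (.refl q) q (.refl q)
  · obtain ⟨_, ⟨a, ⟨⟨r', hr'⟩, -⟩, rfl⟩, q', hq'⟩ := hmust
    obtain ⟨q₁, hq₁⟩ := hq'.exists_tr_of_stable hq
    exact hstuck ⟨_, .com (μ := .out a) hq₁ hr'⟩
  · intro p hp p₁ hp₁ p₂ hp₂
    have h2 : LA.Weak p [] p₂ := LTS.Weak.trans hp₁ hp₂
    obtain ⟨p₃, h3, hst⟩ := ((hconv p hp).weak h2).exists_stable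
    have h4 : LA.Weak p [] p₃ := h2.trans h3
    have hm3 : MustInd LA K p₃ r :=
      MustInd.of_reflTransGen (x := (p, r)) (hm p hp) (h4.reflTransGen hr)
    obtain ⟨_, hs⟩ := hm3.exists_step hr
    cases hs with
    | srv h => exact (hst _ h).elim
    | clt h => exact (hrτ _ h).elim
    | @com _ p₄ _ r' μ h h' =>
      cases μ with
      | inp a => exact (hrout a _ h').elim
      | out a => exact ⟨_, ⟨a, ⟨⟨r', h'⟩, p, hp, p₃, h4, p₄, h⟩, rfl⟩, p₄, h3.trans (.single_vis h)⟩

theorem SetMSLeq.mustInd (hA : LA.ImageFinite)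
    (hout : ∀ p, {a | ∃ p', LA.tr p (.out a) p'}.Finite)
    (hinp : ∀ q a, ∃ q', LB.tr q (.inp a) q')
    {P : Set A} {q : B} {r : C} (hfin : P.Finite) (hm : ∀ p ∈ P, MustInd LA K p r)
    (h : SetMSLeq LA LB P q) : MustInd LB K q r := by
  have hacc := acc_finite_sets (R := Relation.TransGen (UngoodStep LA K))
    (hfin.image fun p => (p, r)) (by
      rintro _ ⟨p, hp, rfl⟩
      exact (hm p hp).acc.transGen)
  generalize hQ : (fun p => (p, r)) '' P = Q at hacc
  induction hacc generalizing P q r with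
  | intro Q _ ih =>
    subst hQ
    by_cases hr : K.good r
    · exact .now hr
    have hconv : ∀ p ∈ P, LA.Converges p := fun p hp => (hm p hp).converges hr
    -- A move of the client goes down in the order on sets; between two such moves, `q` can only
    -- perform `τ`-steps, and it converges because `P` does.
    have hqacc := LB.converges_iff_acc.1 (h [] fun p hp => .nil (hconv p hp)).1.converges
    induction hqacc with
    | intro q _ ihq =>
      refine .of_steps (fun _ => h.exists_step hA hout hinp hr hfin hm)
        (fun _ q' hq' => ihq q' hq' (h.tau hq')) ?_ ?_
      · intro _ r' hr'
        refine ih _ ⟨hfin.image _, h.nonempty.image _, ?_⟩ hfin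
          (fun p hp => (hm p hp).next hr (.clt hr')) h rfl
        rintro _ ⟨p, hp, rfl⟩
        exact ⟨_, ⟨p, hp, rfl⟩, .single ⟨hr, .clt hr'⟩⟩
      · intro _ μ q' r' hq' hr'
        by_cases hg : K.good r'
        · exact .now hg
        have hm' : ∀ p' ∈ {p' | ∃ p ∈ P, LA.Weak p [μ] p'}, MustInd LA K p' r' := by
          rintro p' ⟨p, hp, hp'⟩
          exact MustInd.of_reflTransGen (x := (p, r)) (y := (p', r')) (hm p hp)
            (hp'.transGen hr hg hr').to_reflTransGen
        have h' := h.vis hconv hq'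
        have hfin' : {p' | ∃ p ∈ P, LA.Weak p [μ] p'}.Finite := by
          refine (hfin.biUnion fun p hp => hA.finite_after_single (μ := μ)
            (.cons (hconv p hp) fun p' hp' =>
              .nil ((hm' p' ⟨p, hp, hp'⟩).converges hg))).subset ?_
          rintro p' ⟨p, hp, hp'⟩
          exact Set.mem_biUnion hp hp'
        refine ih _ ⟨hfin'.image _, h'.nonempty.image _, ?_⟩ hfin' hm' h' rfl
        rintro _ ⟨p', ⟨p, hp, hp'⟩, rfl⟩
        exact ⟨_, ⟨p, hp, rfl⟩, hp'.transGen hr hg hr'⟩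

end Sound

/-! ### Completeness for clients with generators -/

section Complete

variable {N : Type u} {S : Type v} {C : Type w} {L : LTS N S} {K : ClientLTS N C}

theorem GenSpec.mustInd_of_weak {g : List (VisAct N) → C} (hg : GenSpec K g) {p p' : S}
    {s : List (VisAct N)} (s' : List (VisAct N)) (h : L.Weak p s p')
    (hm : MustInd L K p (g (s ++ s'))) : MustInd L K p' (g s') := by
  induction h with
  | refl => exact hm
  | tau h _ ih => exact ih (hm.next (hg.ungood _) (.srv h))
  | vis h _ ih =>
    obtain ⟨r, h1, h2⟩ := hg.step_co _ _
    exact ih ((hm.next (hg.ungood _) (.com h h1)).eqv h2)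

theorem GenSpec.convAlong {g : List (VisAct N) → C} (hg : GenSpec K g) {p : S}
    {s : List (VisAct N)} (hm : MustInd L K p (g s)) : L.ConvAlong p s := by
  induction s generalizing p with
  | nil => exact .nil (hm.converges (hg.ungood _))
  | cons μ s ih =>
    exact .cons (hm.converges (hg.ungood _)) fun p' h => ih (hg.mustInd_of_weak (s := [μ]) s h hm)

/-- A forwarder satisfies the test generated by a trace as soon as some property, which it has,
implies convergence, is inherited along the trace, and suffices at its end. At an input `a` of the
trace the generator merely outputs `ā`, which is moved into the mailbox. -/
theorem GenSpec.mustInd_fw {g : List (VisAct N) → C} (hg : GenSpec K g)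
    (Φ : S × Multiset N → List (VisAct N) → Prop)
    (hconv : ∀ {x s}, Φ x s → L.FW.Converges x)
    (hτ : ∀ {x y s}, Φ x s → L.FW.tr x .tau y → Φ y s)
    (hvis : ∀ {x y μ s}, Φ x (μ :: s) → L.FW.tr x (.vis μ) y → Φ y s)
    (hnil : ∀ {x}, Φ x [] → MustInd L.FW K x (g []))
    {x : S × Multiset N} {s : List (VisAct N)} (h : Φ x s) : MustInd L.FW K x (g s) := by
  induction s generalizing x with
  | nil => exact hnil h
  | cons μ s ih =>
    cases μ with
    | inp a =>
      obtain ⟨p, M⟩ := x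
      obtain ⟨r, h1, h2⟩ := hg.step_co (.inp a) s
      rw [← mustInd_fw_cons_iff h1]
      exact (ih (hvis h .minp)).eqv (K.eqv_equivalence.symm h2)
    | out a =>
      have hacc := L.FW.converges_iff_acc.1 (hconv h)
      induction hacc with
      | intro x _ ihx =>
        refine .of_steps (fun _ => ?_) (fun _ y hy => ihx y hy (hτ h hy))
          (fun _ r hr => .now (hg.out_tau_good a s r hr)) (fun _ μ y r hy hr => ?_)
        · obtain ⟨r, hr⟩ := hg.out_tau a s
          exact ⟨_, .clt hr⟩
        · obtain ⟨hμ, rfl⟩ := hg.out_vis a s _ _ hr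
          have hμ' : μ = .out a := by rw [← μ.co_co, hμ]; rfl
          subst hμ'
          exact ih (hvis h hy)

theorem ConvGenSpec.mustInd_fw_iff {f : List (VisAct N) → C} (hf : ConvGenSpec K f)
    {x : S × Multiset N} {s : List (VisAct N)} :
    MustInd L.FW K x (f s) ↔ L.FW.ConvAlong x s := by
  refine ⟨hf.toGenSpec.convAlong, hf.toGenSpec.mustInd_fw L.FW.ConvAlong (·.converges)
    (fun h hy => h.tau hy) (fun h hy => h.weak (.single_vis hy)) fun {x} h => ?_⟩
  have hacc := L.FW.converges_iff_acc.1 h.converges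
  induction hacc with
  | intro x _ ih =>
    refine .of_steps (fun _ => ?_) (fun _ y hy => ih y hy (h.tau hy))
      (fun _ r hr => .now (hf.nil_tau_good r hr)) (fun _ μ y r hy hr => (hf.nil_vis _ _ hr).elim)
    obtain ⟨r, hr⟩ := hf.nil_tau
    exact ⟨_, .clt hr⟩

theorem AccGenSpec.mustInd_fw_iff {f : List (VisAct N) → Finset N → C} (hf : AccGenSpec K f)
    {x : S × Multiset N} {s : List (VisAct N)} {E : Finset N} (hx : L.FW.ConvAlong x s) :
    MustInd L.FW K x (f s E) ↔ L.FW.MustSet (L.FW.after x s) (VisAct.out '' (E : Set N)) := by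
  constructor
  · intro h y hy z hz
    have hm : MustInd L.FW K z (f [] E) := by
      refine (hf.gen E).mustInd_of_weak [] (hy.trans hz) ?_
      simpa using h
    clear h hy hz
    generalize hr : f [] E = r at hm
    induction hm with
    | now h => exact ((hf.gen E).ungood [] (hr ▸ h)).elim
    | step _ hred _ ih =>
      subst hr
      obtain ⟨_, hs⟩ := hred
      cases hs with
      | srv h =>
        obtain ⟨μ, hμ, z', hz'⟩ := ih _ _ (.srv h) rfl
        exact ⟨μ, hμ, z', .tau h hz'⟩
      | clt h => exact (hf.nil_tau E _ h).elim
      | @com _ z' _ r μ h h' =>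
        cases μ with
        | inp a => exact (hf.nil_out E a _ h').elim
        | out a => exact ⟨_, ⟨a, (hf.nil_inp E a).1 ⟨_, h'⟩, rfl⟩, z', .single_vis h⟩
  · intro h
    refine (hf.gen E).mustInd_fw (fun x s => L.FW.ConvAlong x s ∧
        L.FW.MustSet (L.FW.after x s) (VisAct.out '' (E : Set N))) (·.1.converges)
      (fun h hy => ⟨h.1.tau hy, fun z hz => h.2 z (.tau hy hz)⟩)
      (fun h hy => ⟨h.1.weak (.single_vis hy), fun z hz => h.2 z (.vis hy hz)⟩)
      (fun {x} h => ?_) ⟨hx, h⟩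
    obtain ⟨hc, hmust⟩ := h
    have hacc := L.FW.converges_iff_acc.1 hc.converges
    induction hacc with
    | intro x _ ih =>
      refine .of_steps (fun _ => ?_)
        (fun _ y hy => ih y hy (hc.tau hy) fun z hz => hmust z (.tau hy hz))
        (fun _ r hr => (hf.nil_tau E r hr).elim)
        (fun _ μ y r _ hr => .now (hf.nil_vis_good E _ _ hr))
      by_cases hτ : ∃ y, L.FW.tr x .tau y
      · obtain ⟨y, hy⟩ := hτ
        exact ⟨_, .srv hy⟩
      · obtain ⟨_, ⟨a, ha, rfl⟩, y, hy⟩ := hmust x (.refl x) x (.refl x)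
        obtain ⟨z, hz⟩ := hy.exists_tr_of_stable (not_exists.1 hτ)
        obtain ⟨r, hr⟩ := (hf.nil_inp E a).2 ha
        exact ⟨_, .com (μ := .out a) hz hr⟩

/-- Forwarders accept every input, so a set with an input is a must-set of every set of states. -/
theorem mustSet_fw_of_inp_mem {P : Set (S × Multiset N)} {X : Set (VisAct N)} {a : N}
    (ha : .inp a ∈ X) : L.FW.MustSet P X :=
  fun _ _ y _ => ⟨.inp a, ha, (y.1, a ::ₘ y.2), .single_vis .minp⟩

theorem exists_finset_of_inp_notMem {X : Set (VisAct N)} (hX : X.Finite)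
    (h : ∀ a, .inp a ∉ X) : ∃ E : Finset N, X = VisAct.out '' (E : Set N) := by
  have hinj : Function.Injective (VisAct.out : N → VisAct N) := fun _ _ h => VisAct.out.inj h
  refine ⟨(hX.preimage hinj.injOn).toFinset, ?_⟩
  rw [Set.Finite.coe_toFinset, Set.image_preimage_eq_inter_range, eq_comm, Set.inter_eq_left]
  rintro (a | a) hμ
  · exact (h a hμ).elim
  · exact ⟨a, rfl⟩

end Complete

theorem mustLeqFor_iff_mustInd_fw {N : Type u} {A : Type v} {B : Type w} {C : Type x}
    {LA : LTS N A} {LB : LTS N B} {K : ClientLTS N C} {p : A} {q : B} :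
    MustLeqFor LA LB K p q ↔ ∀ r, MustInd LA.FW K (p, 0) r → MustInd LB.FW K (q, 0) r :=
  forall_congr' fun _ => imp_congr must_iff_mustInd_fw must_iff_mustInd_fw

theorem MustLeqFor.msLeq_fw {N : Type u} {A : Type v} {B : Type w} {C : Type x}
    {LA : LTS N A} {LB : LTS N B} {K : ClientLTS N C} (hK : K.HasGenerators) {p : A} {q : B}
    (h : MustLeqFor LA LB K p q) : MSLeq LA.FW LB.FW (p, 0) (q, 0) := by
  rw [mustLeqFor_iff_mustInd_fw] at h
  obtain ⟨⟨f, hf⟩, f', hf'⟩ := hK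
  have hcnv : CnvLeq LA.FW LB.FW (p, 0) (q, 0) := fun s hs =>
    hf.mustInd_fw_iff.1 (h _ (hf.mustInd_fw_iff.2 hs))
  refine ⟨hcnv, fun s hs X hX hXp => ?_⟩
  by_cases hinp : ∃ a, .inp a ∈ X
  · obtain ⟨a, ha⟩ := hinp
    exact mustSet_fw_of_inp_mem ha
  · obtain ⟨E, rfl⟩ := exists_finset_of_inp_notMem hX (not_exists.1 hinp)
    exact (hf'.mustInd_fw_iff (hcnv s hs)).1 (h _ ((hf'.mustInd_fw_iff hs).2 hXp))

theorem MSLeq.mustLeqFor {N : Type u} {A : Type v} {B : Type w} {C : Type x}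
    {LA : FdbLTS N A} {LB : LTS N B} {K : ClientLTS N C} (hA : LA.ImageFinite) {p : A} {q : B}
    (h : MSLeq LA.FW LB.FW (p, 0) (q, 0)) : MustLeqFor LA.toLTS LB K p q := by
  rw [mustLeqFor_iff_mustInd_fw]
  exact fun r hr => h.singleton.mustInd hA.fw LA.finite_outputs_fw
    (fun y a => ⟨(y.1, a ::ₘ y.2), FWStep.minp⟩) (Set.finite_singleton _) (by simpa using hr)

/-! ### A client LTS with generators -/

/-- The transitions of processes with an output buffer. A process without its buffer is given by
`T : D → Option N → D × Multiset N → Prop`: a step is an input (`some a`) or a `τ` (`none`), and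
adds a multiset of outputs to the buffer. Buffered outputs are available to the environment and to
the process itself. -/
inductive BufferStep {N : Type u} {D : Type v} (T : D → Option N → D × Multiset N → Prop) :
    D × Multiset N → Act N → D × Multiset N → Prop
  | tau {d d' : D} {M M' : Multiset N} :
      T d none (d', M') → BufferStep T (d, M) .tau (d', M' + M)
  | inp {d d' : D} {M M' : Multiset N} {a : N} :
      T d (some a) (d', M') → BufferStep T (d, M) (.inp a) (d', M' + M)
  | out {d : D} {M : Multiset N} {a : N} : BufferStep T (d, a ::ₘ M) (.out a) (d, M)
  | comm {d d' : D} {M M' : Multiset N} {a : N} :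
      T d (some a) (d', M') → BufferStep T (d, a ::ₘ M) .tau (d', M' + M)

section Buffer

variable {N : Type u} {D : Type v} {T : D → Option N → D × Multiset N → Prop}

theorem BufferStep.out_iff {x y : D × Multiset N} {a : N} :
    BufferStep T x (.out a) y ↔ x = (y.1, a ::ₘ y.2) := by
  constructor
  · rintro ⟨⟩
    rfl
  · rintro rfl
    exact .out

theorem BufferStep.cons {d d' : D} {M M' : Multiset N} {α : Act N} (a : N)
    (h : BufferStep T (d, M) α (d', M')) : BufferStep T (d, a ::ₘ M) α (d', a ::ₘ M') := by
  cases h with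
  | tau h => rw [← Multiset.add_cons]; exact .tau h
  | inp h => rw [← Multiset.add_cons]; exact .inp h
  | out => rw [Multiset.cons_swap]; exact .out
  | comm h => rw [← Multiset.add_cons, Multiset.cons_swap]; exact .comm h

theorem BufferStep.of_empty {d : D} {α : Act N} {y : D × Multiset N}
    (h : BufferStep T (d, 0) α y) :
    α = .tau ∧ T d none y ∨ ∃ a, α = .inp a ∧ T d (some a) y := by
  generalize hM : (0 : Multiset N) = M at h
  cases h with
  | tau h => subst hM; exact .inl ⟨rfl, by rwa [add_zero]⟩
  | inp h => subst hM; exact .inr ⟨_, rfl, by rwa [add_zero]⟩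
  | out => exact (Multiset.cons_ne_zero hM.symm).elim
  | comm => exact (Multiset.cons_ne_zero hM.symm).elim

/-- Processes with an output buffer are output-buffered agents with feedback, up to equality. -/
def bufferFdb (T : D → Option N → D × Multiset N → Prop) : FdbLTS N (D × Multiset N) where
  tr := BufferStep T
  eqv := Eq
  eqv_equivalence := eq_equivalence
  eqv_compat := by
    rintro p q q' α rfl h
    exact ⟨q', h, rfl⟩
  output_commutativity := by
    intro p p' q a α h h'
    rw [BufferStep.out_iff] at h
    subst h
    exact ⟨(q.1, a ::ₘ q.2), q, h'.cons a, .out, rfl⟩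
  feedback := by
    intro p p' q a h h'
    rw [BufferStep.out_iff] at h
    subst h
    obtain ⟨d, M⟩ := p'
    cases h' with
    | inp h' => exact ⟨_, .comm h', rfl⟩
  output_confluence := by
    intro p p' p'' a μ hμ h h'
    rw [BufferStep.out_iff] at h
    subst h
    obtain ⟨d, M⟩ := p'
    generalize hM : a ::ₘ M = M₀ at h'
    cases h' with
    | inp h' =>
      subst hM
      exact ⟨_, _, .inp h', by rw [Multiset.add_cons]; exact .out, rfl⟩
    | @out _ M₁ b =>
      rcases Multiset.cons_eq_cons.1 hM with ⟨rfl, -⟩ | ⟨_, M₂, rfl, rfl⟩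
      · exact (hμ rfl).elim
      · exact ⟨_, _, .out, .out, rfl⟩
  output_determinacy := by
    intro p p' p'' a h h'
    rw [BufferStep.out_iff] at h h'
    rw [h, Prod.mk.injEq, Multiset.cons_inj_right] at h'
    exact Prod.ext h'.1 h'.2
  output_tau := by
    intro p p' p'' a h h'
    rw [BufferStep.out_iff] at h
    subst h
    obtain ⟨d, M⟩ := p'
    generalize hM : a ::ₘ M = M₀ at h'
    cases h' with
    | tau h' =>
      subst hM
      exact .inl ⟨_, _, .tau h', by rw [Multiset.add_cons]; exact .out, rfl⟩
    | @comm _ _ M₁ M' b h' =>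
      rcases Multiset.cons_eq_cons.1 hM with ⟨rfl, rfl⟩ | ⟨_, M₂, rfl, rfl⟩
      · exact .inr ⟨_, .inp h', rfl⟩
      · exact .inl ⟨_, _, .comm h', by rw [Multiset.add_cons]; exact .out, rfl⟩
  backward_output_determinacy := by
    intro p' p'' q' q'' a h h' he
    rw [BufferStep.out_iff] at h h'
    rw [h, h', he]
  exists_mbox := by
    refine ⟨Prod.snd, fun p a => ⟨fun h => ?_, ?_⟩, fun p a p' h => ?_⟩
    · obtain ⟨M, hM⟩ := Multiset.exists_cons_of_mem h
      exact ⟨(p.1, M), BufferStep.out_iff.2 (Prod.ext rfl hM)⟩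
    · rintro ⟨p', h⟩
      rw [BufferStep.out_iff.1 h]
      exact Multiset.mem_cons_self _ _
    · rw [BufferStep.out_iff.1 h]

end Buffer

/-- Buffer-free parts of the test clients. The parameter `E` distinguishes the tests for
convergence (`none`) from those for acceptance sets (`some E`). The universe parameter `t` only
serves to place the clients in a prescribed universe. -/
inductive TestState (N : Type u) : Type (max u t)
  /-- the good state -/
  | ok : TestState N
  /-- the test at the end of its trace -/
  | fin (E : Option (Finset N)) : TestState N
  /-- the test for the trace `ā.s`, which waits for `ā` -/
  | wait (a : N) (s : List (VisAct N)) (E : Option (Finset N)) : TestState N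

/-- The test for the trace `s`: the complements of inputs that are due are put into the buffer. -/
def testClient {N : Type u} (E : Option (Finset N)) :
    List (VisAct N) → TestState.{u, t} N × Multiset N
  | [] => (.fin E, 0)
  | .inp a :: s => ((testClient E s).1, a ::ₘ (testClient E s).2)
  | .out a :: s => (.wait a s E, 0)

/-- The steps of the buffer-free parts of test clients. -/
inductive TestStep {N : Type u} :
    TestState.{u, t} N → Option N → TestState.{u, t} N × Multiset N → Prop
  | fin_tau : TestStep (.fin none) none (.ok, 0)
  | fin_inp {E : Finset N} {a : N} : a ∈ E → TestStep (.fin (some E)) (some a) (.ok, 0)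
  | wait_tau {a : N} {s : List (VisAct N)} {E : Option (Finset N)} :
      TestStep (.wait a s E) none (.ok, 0)
  | wait_inp {a : N} {s : List (VisAct N)} {E : Option (Finset N)} :
      TestStep (.wait a s E) (some a) (testClient E s)

/-- The LTS of test clients. -/
def testLTS (N : Type u) : ClientLTS N (TestState.{u, t} N × Multiset N) where
  toFdbLTS := bufferFdb TestStep
  good x := x.1 = .ok
  good_output h := by rw [BufferStep.out_iff.1 h]
  good_eqv h := by rw [show _ = _ from h]

theorem testLTS_genSpec {N : Type u} (E : Option (Finset N)) :
    GenSpec (testLTS.{u, t} N) (testClient E) where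
  ungood s := by
    induction s with
    | nil => exact fun h => TestState.noConfusion rfl (heq_of_eq h)
    | cons μ s ih =>
      cases μ with
      | inp a => exact ih
      | out a => exact fun h => TestState.noConfusion rfl (heq_of_eq h)
  step_co μ s := by
    cases μ with
    | inp a => exact ⟨_, BufferStep.out, rfl⟩
    | out a => exact ⟨_, BufferStep.inp .wait_inp, Prod.ext rfl (add_zero _)⟩
  out_tau a s := ⟨_, BufferStep.tau .wait_tau⟩
  out_tau_good a s r h := by
    rcases BufferStep.of_empty h with ⟨-, h⟩ | ⟨_, h, -⟩
    · cases h
      rfl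
    · cases h
  out_vis a s μ r h := by
    rcases BufferStep.of_empty h with ⟨h, -⟩ | ⟨b, hμ, hT⟩
    · cases h
    · cases hμ
      cases hT
      exact ⟨rfl, rfl⟩

theorem testLTS_hasGenerators {N : Type u} : (testLTS.{u, t} N).HasGenerators := by
  refine ⟨⟨testClient none, ⟨testLTS_genSpec none, ?_, ⟨_, BufferStep.tau .fin_tau⟩, ?_⟩⟩,
    fun s E => testClient (some E) s, ⟨fun E => testLTS_genSpec (some E), ?_, ?_, ?_, ?_⟩⟩
  · intro μ r h
    rcases BufferStep.of_empty h with ⟨h, -⟩ | ⟨_, -, h⟩ <;> cases h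
  · intro r h
    rcases BufferStep.of_empty h with ⟨-, h⟩ | ⟨_, h, -⟩
    · cases h
      rfl
    · cases h
  · intro E r h
    rcases BufferStep.of_empty h with ⟨-, h⟩ | ⟨_, h, -⟩ <;> cases h
  · intro E a r h
    rcases BufferStep.of_empty h with ⟨h, -⟩ | ⟨_, h, -⟩ <;> cases h
  · intro E a
    constructor
    · rintro ⟨r, h⟩
      rcases BufferStep.of_empty h with ⟨h, -⟩ | ⟨b, hb, hT⟩
      · cases h
      · cases hb
        cases hT
        assumption
    · exact fun h => ⟨_, BufferStep.inp (.fin_inp h)⟩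
  · intro E μ r h
    rcases BufferStep.of_empty h with ⟨h, -⟩ | ⟨_, -, h⟩
    · cases h
    · cases h
      rfl

end MustTesting

open MustTesting
theorem mainTheorem2 {N : Type u} {A : Type v} {B : Type w}
    (LA : FdbLTS N A) (LB : FdbLTS N B) (hA : LA.ImageFinite) (p : A) (q : B) :
    (MustLeq.{u, v, w, max u t} LA.toLTS LB.toLTS p q ↔ MSLeq LA.FW LB.FW (p, 0) (q, 0)) ∧
    (∀ (C : Type x) (K : ClientLTS N C), K.HasGenerators →
      (MustLeqFor LA.toLTS LB.toLTS K p q ↔ MSLeq LA.FW LB.FW (p, 0) (q, 0))) :=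
  ⟨⟨fun h => MustLeqFor.msLeq_fw testLTS_hasGenerators.{u, t}
      (h (TestState.{u, t} N × Multiset N) (testLTS N)),
    fun h _ _ => h.mustLeqFor hA⟩,
    fun _ _ hK => ⟨fun h => h.msLeq_fw hK, fun h => h.mustLeqFor hA⟩⟩
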